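/- **Data and notation.** Let $P_1,\dots,P_N$ be nodes in the plane, and write $\mathbf n(\varphi)=(\cos\varphi,\sin\varphi)$. Either the data are open ($N\ge 2$, with prescribed end tangents $\mathbf n(\tau_1)$ at $P_1$ and $\mathbf n(\tau_N)$ at $P_N$), or they are closed ($N\ge 3$, indices modulo $N$). Chords are $P_jP_{j+1}$, with $1\le j\le N-1$ (open) or all $j$ (closed); neighbouring nodes are distinct, and so are $P_{j-1}$ and $P_{j+1}$ for every node $P_j$ (in the open case $1<j<N$). Let $2c_j=|P_jP_{j+1}|$ and let $\mu_j$ be the direction angle of the chord $P_jP_{j+1}$; in the open case put $c_0=c_N=0$, $\mu_0=\tau_1$, $\mu_N=\tau_N$. Let $$\rho_j=\mu_j-\mu_{j-1}\in(-\pi,\pi]\ (\text{mod }2\pi),\qquad d_j=\sqrt{c_{j-1}^2+2c_{j-1}c_j\cos\rho_j+c_j^2},\qquad q_j=\frac{\sin\rho_j}{d_j}$$ ($q_j$ is the three-point curvature, i.e. the signed curvature of the circle $P_{j-1}P_jP_{j+1}$), and let $\xi_j,\eta_j\in(-\pi,\pi]$ be given by $$\sin\xi_j=-\frac{c_j\sin\rho_j}{d_j},\quad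 \cos\xi_j=\frac{c_{j-1}+c_j\cos\rho_j}{d_j},\qquad \sin\eta_j=\frac{c_j\sin\rho_{j+1}}{d_{j+1}},\quad \cos\eta_j=\frac{c_{j+1}+c_j\cos\rho_{j+1}}{d_{j+1}}.$$ Assume $c_{j-1}+c_j\cos\rho_j\ge0$ and $c_j+c_{j-1}\cos\rho_j\ge0$ at every node (neither of the arcs $P_{j-1}P_j$, $P_jP_{j+1}$ of the circle $P_{j-1}P_jP_{j+1}$ exceeds $180^\circ$). For $|x|\le c$ and $|\varphi|<\pi$ put $$A(x;c,\varphi)=\frac{(c^2-x^2)\sin\varphi}{c\cos\varphi+\sqrt{c^2-x^2\sin^2\varphi}}\qquad(A(\pm c;c,\varphi)=0);$$ for $|\varphi|\le\pi/2$ this is the circular arc over $[-c,c]$ starting at $(-c,0)$ with tangent $\mathbf n(\varphi)$, and for $\pi/2<|\varphi|<\pi$ it is the part of that arc farthest from the chord, over $|x|<c$. **Curve.** Let a curve with continuous tangent and curvature $k$ ($k$ need not be continuous; the tangent angle is the integral of $k$ with respect to arc length) pass through the nodes in order (with the prescribed end tangents if open; closed if the data are closed). Assume that each segment $P_jP_{j+1}$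 is one-to-one projectable onto its chord, and that $k$ is monotone on each segment. A vertex of the curve is a place where $k$ passes from nondecreasing to nonincreasing or conversely; so all vertices are at nodes (interior nodes, in the open case). Assume that (a) the nodes where the sequence $q_j$ has a minimum or maximum are exactly the vertices of the curve (of a run of equal extremal values any one node may be chosen); (b) there is at least one node between any two neighbouring vertices. **Proposition 3.** On each chord $P_jP_{j+1}$, in the coordinates in which this chord is the segment $[-c_j,c_j]$ of the $x$-axis, the segment of the curve lies between the following two arcs: | vertex at $P_j$ | vertex at $P_{j+1}$ | first arc | second arc | |---|---|---|---| | yes | no | $A(x;c_j,-\eta_j)$ | $A(x;c_j,-\xi_{j-1}-\rho_j)$ | | no | yes | $A(x;c_j,\eta_{j+1}-\rho_{j+1})$ | $A(x;c_j,\xi_j)$ | | no | no | $A(x;c_j,-\eta_j)$ | $A(x;c_j,\xi_j)$ | More precisely, every point $(x,y)$ of the segment satisfies $\text{first arc}\le y\le\text{second arc}$ if $k$ is nondecreasing on the segment, and $\text{second arc}\le y\le\text{first arc}$ if $k$ is nonincreasing. Here a bound by one of the corrected arcs, with angle $\varphi=-\xi_{j-1}-\rho_j$ or $\varphi=\eta_{j+1}-\rho_{j+1}$,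 is claimed whenever $|\varphi|<\pi$; the other bounds hold without this condition. -/

import Mathlib

noncomputable section

/-- The unit vector `n(φ) = (cos φ, sin φ)`; the plane is identified with `ℂ`. -/
def nvec (φ : ℝ) : ℂ := Complex.exp (φ * Complex.I)

/-! ### Chords, turning angles, three-point curvatures

`c j` is the half-length and `μ j` the direction angle of the `j`-th (pseudo-)chord. -/

/-- Half-length of the chord `P_j P_{j+1}`. -/
def chordHalf (P : ℤ → ℂ) (j : ℤ) : ℝ := ‖P (j + 1) - P j‖ / 2

/-- Direction angle of the chord `P_j P_{j+1}`. -/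
def chordDir (P : ℤ → ℂ) (j : ℤ) : ℝ := Complex.arg (P (j + 1) - P j)

/-- Half-lengths for data `P_1, …, P_N` with end tangents: the pseudo-chords before `P_1` and
after `P_N` have length zero. -/
def openHalf (P : ℤ → ℂ) (N : ℤ) (j : ℤ) : ℝ :=
  if 1 ≤ j ∧ j < N then chordHalf P j else 0

/-- Directions for data `P_1, …, P_N` with end tangents `n(τ₁)`, `n(τ₂)`: the pseudo-chords before
`P_1` and after `P_N` have the directions of the end tangents. -/
def openDir (P : ℤ → ℂ) (N : ℤ) (τ₁ τ₂ : ℝ) (j : ℤ) : ℝ :=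
  if j < 1 then τ₁ else if j < N then chordDir P j else τ₂

/-- The turning angle `ρ_j = μ_j - μ_{j-1}`, reduced to `(-π, π]`. -/
def turn (μ : ℤ → ℝ) (j : ℤ) : ℝ := ((μ j - μ (j - 1) : ℝ) : Real.Angle).toReal

/-- `d_j`, half the distance from `P_{j-1}` to `P_{j+1}`. -/
def dist3 (c μ : ℤ → ℝ) (j : ℤ) : ℝ :=
  Real.sqrt (c (j - 1) ^ 2 + 2 * c (j - 1) * c j * Real.cos (turn μ j) + c j ^ 2)

/-- The signed three-point curvature `q_j = sin ρ_j / d_j` of the directed circle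
`P_{j-1} P_j P_{j+1}`. -/
def curv3 (c μ : ℤ → ℝ) (j : ℤ) : ℝ := Real.sin (turn μ j) / dist3 c μ j

/-- `ξ_j`, the direction at `P_j` of the circular arc `P_{j-1} P_j P_{j+1}` with respect to `μ_j`:
the angle with `d_j cos ξ_j = c_{j-1} + c_j cos ρ_j` and `d_j sin ξ_j = -c_j sin ρ_j`. -/
def xi (c μ : ℤ → ℝ) (j : ℤ) : ℝ :=
  Complex.arg ⟨c (j - 1) + c j * Real.cos (turn μ j), -(c j * Real.sin (turn μ j))⟩

/-- `η_j`, the direction at `P_{j+1}` of the circular arc `P_j P_{j+1} P_{j+2}` with respect to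
`μ_j`: the angle with `d_{j+1} cos η_j = c_{j+1} + c_j cos ρ_{j+1}` and
`d_{j+1} sin η_j = c_j sin ρ_{j+1}`. -/
def eta (c μ : ℤ → ℝ) (j : ℤ) : ℝ :=
  Complex.arg ⟨c (j + 1) + c j * Real.cos (turn μ (j + 1)), c j * Real.sin (turn μ (j + 1))⟩

/-- Neither of the two arcs `P_{j-1} P_j`, `P_j P_{j+1}` of the circle `P_{j-1} P_j P_{j+1}`
exceeds 180°. -/
def AtMostHalfTurn (c μ : ℤ → ℝ) (j : ℤ) : Prop :=
  0 ≤ c (j - 1) + c j * Real.cos (turn μ j) ∧ 0 ≤ c j + c (j - 1) * Real.cos (turn μ j)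

/-! ### Circular arcs and local coordinates -/

/-- `A(x; c, φ)`, the circular arc over the segment `[-c, c]` of the `x`-axis that starts at
`(-c, 0)` with the tangent `n(φ)`. -/
def arcA (x c φ : ℝ) : ℝ :=
  (c ^ 2 - x ^ 2) * Real.sin φ /
    (c * Real.cos φ + Real.sqrt (c ^ 2 - x ^ 2 * Real.sin φ ^ 2))

/-- The point `z` in the coordinates `x + i y` in which the `j`-th chord is `[-c_j, c_j]` on the
`x`-axis. -/
def localCoord (P : ℤ → ℂ) (j : ℤ) (z : ℂ) : ℂ :=
  (z - (P j + P (j + 1)) / 2) * nvec (-chordDir P j)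

/-! ### Curves, monotone curvature, vertices -/

/-- `γ` is a plane curve parametrized by arc length on `S`, with tangent angle `θ` and curvature
function `k` (not required to be continuous). -/
structure IsCurveOn (γ : ℝ → ℂ) (θ k : ℝ → ℝ) (S : Set ℝ) : Prop where
  tangent : ∀ s ∈ S, HasDerivWithinAt γ (nvec (θ s)) S s
  integrable : ∀ s ∈ S, ∀ s' ∈ S, IntervalIntegrable k MeasureTheory.volume s s'
  curvature : ∀ s ∈ S, ∀ s' ∈ S, θ s' - θ s = ∫ u in s..s', k u

/-- The sense of monotonicity `up` (`up j`: nondecreasing on the `j`-th chord; otherwise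
nonincreasing) changes exactly at those of the nodes `inner` that belong to `V`. -/
def TurnsExactlyAt (up : ℤ → Prop) (inner V : Set ℤ) : Prop :=
  ∀ j ∈ inner, (j ∈ V ↔ ¬(up (j - 1) ↔ up j))

/-- The curvature `k` is monotone on each of the arcs between neighbouring nodes, in the sense
`up`, and the vertices of the curve (where the sense changes) are exactly the nodes in `V`. -/
def VerticesOfCurve (k : ℝ → ℝ) (t : ℤ → ℝ) (up : ℤ → Prop) (chords inner V : Set ℤ) : Prop :=
  (∀ j ∈ chords, (up j → MonotoneOn k (Set.Icc (t j) (t (j + 1)))) ∧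
    (¬ up j → AntitoneOn k (Set.Icc (t j) (t (j + 1))))) ∧
  TurnsExactlyAt up inner V

/-- The nodes where the sequence `q` has a minimum or maximum are exactly the nodes in `V`.
If neighbouring terms differ this says that `V` is the set of strict local extrema among `inner`;
of a run of equal terms forming an extremum any one node may be taken into `V`. -/
def ExtremaOfSequence (q : ℤ → ℝ) (chords inner V : Set ℤ) : Prop :=
  ∃ up : ℤ → Prop,
    (∀ j ∈ chords, (up j → q j ≤ q (j + 1)) ∧ (¬ up j → q (j + 1) ≤ q j)) ∧
    TurnsExactlyAt up inner V

/-- The curve `γ` with the nodes `P_j = γ (t j)`, `j ∈ nodes`, is a piecewise spiral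
interpolant whose distinguished vertices are the nodes in `V`. -/
structure IsPiecewiseSpiral (P : ℤ → ℂ) (c μ : ℤ → ℝ) (γ : ℝ → ℂ) (θ k : ℝ → ℝ) (t : ℤ → ℝ)
    (up : ℤ → Prop) (chords nodes inner V : Set ℤ) (S : Set ℝ) : Prop where
  curve : IsCurveOn γ θ k S
  param : StrictMonoOn t nodes
  interp : ∀ j ∈ nodes, γ (t j) = P j
  /-- consecutive nodes are distinct, so that chords and three-point circles exist -/
  distinct : ∀ j ∈ chords, P j ≠ P (j + 1)
  distinct3 : ∀ j ∈ inner, P (j - 1) ≠ P (j + 1)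
  /-- each arc between neighbouring nodes is one-to-one projectable onto its chord -/
  projectable : ∀ j ∈ chords,
    Set.InjOn (fun s => (localCoord P j (γ s)).re) (Set.Icc (t j) (t (j + 1)))
  halfTurn : ∀ j ∈ nodes, AtMostHalfTurn c μ j
  vertices_inner : V ⊆ inner
  /-- the vertices of the curve are exactly the nodes in `V` … -/
  vertices_curve : VerticesOfCurve k t up chords inner V
  /-- … and these are exactly the nodes of minimal or maximal three-point curvature -/
  vertices_data : ExtremaOfSequence (curv3 c μ) chords inner V
  /-- there is at least one node between two neighbouring vertices -/
  separated : ∀ j ∈ V, j + 1 ∉ V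

/-! ### The table of boundary arcs -/

/-- In local coordinates the point `z = x + i y` satisfies `A(x; c, φ) ≤ y` if the curvature is
nondecreasing on the chord, and `y ≤ A(x; c, φ)` if it is nonincreasing. -/
def FirstBound (up : Prop) (c φ : ℝ) (z : ℂ) : Prop :=
  (up → arcA z.re c φ ≤ z.im) ∧ (¬ up → z.im ≤ arcA z.re c φ)

/-- The opposite bound. -/
def SecondBound (up : Prop) (c φ : ℝ) (z : ℂ) : Prop :=
  (up → z.im ≤ arcA z.re c φ) ∧ (¬ up → arcA z.re c φ ≤ z.im)

/-- The segment of the curve on the `j`-th chord lies between the two boundary arcs, given by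
whether `P_j` and `P_{j+1}` are vertices. A corrected arc bounds the segment
whenever its angle is less than `π` in absolute value, so that there is such an arc. -/
def BoundedByTable (P : ℤ → ℂ) (c μ : ℤ → ℝ) (γ : ℝ → ℂ) (t : ℤ → ℝ) (up : ℤ → Prop)
    (V : Set ℤ) (j : ℤ) : Prop :=
  ∀ s ∈ Set.Icc (t j) (t (j + 1)),
    (j ∈ V → j + 1 ∉ V →
      FirstBound (up j) (c j) (-eta c μ j) (localCoord P j (γ s)) ∧
      (|-xi c μ (j - 1) - turn μ j| < Real.pi →
        SecondBound (up j) (c j) (-xi c μ (j - 1) - turn μ j) (localCoord P j (γ s)))) ∧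
    (j ∉ V → j + 1 ∈ V →
      (|eta c μ (j + 1) - turn μ (j + 1)| < Real.pi →
        FirstBound (up j) (c j) (eta c μ (j + 1) - turn μ (j + 1)) (localCoord P j (γ s))) ∧
      SecondBound (up j) (c j) (xi c μ j) (localCoord P j (γ s))) ∧
    (j ∉ V → j + 1 ∉ V →
      FirstBound (up j) (c j) (-eta c μ j) (localCoord P j (γ s)) ∧
      SecondBound (up j) (c j) (xi c μ j) (localCoord P j (γ s)))

end

noncomputable section

/-! ### Circular arcs -/

/-! Put a chord on the x-axis and let α, β be the angles of the end tangents of its segment with the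
chord. Suppose k is nondecreasing; reflection in the chord gives the other case. Projectability
keeps the tangent angle θ in [-π/2, π/2], and sin θ is a primitive of k with respect to x. On the
circular arc with the same start tangent, the sine of the tangent angle is κx with κ = -sin α / c.
So sin θ - κx starts at 0, becomes positive only after k has exceeded κ, and cannot decrease from
then on. As the height over the arc vanishes at both ends, the segment lies below the arc
(`y_le_arcA`), and k ≤ κ at the start (`curvature_start_le`). Traversing backwards, the arc with the
same end tangent lies below the segment, and k ≥ sin β / c at the end. Comparing the two arcs gives
Vogt's inequality α + β ≥ 0.

The true tangents are unknown, but arcs increase with their angle (`arcA_mono`), so it suffices to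
bound α and β by the angles of the table. At a node that is not a vertex, the two adjoining chords
bound the same node curvature from opposite sides; eliminating it gives sin(α_j - ξ_j) ≤ 0, hence
α_j ≤ ξ_j, and similarly β_j ≤ η_j at the far end (`tangent_bounds_of_not_mem`). At a prescribed end
tangent there is equality. At a vertex P_j, k is nonincreasing on the preceding chord, whose start
is not a vertex; there α_{j-1} ≥ ξ_{j-1} and α_{j-1} + β_{j-1} ≤ 0, so α_j = β_{j-1} - ρ_j ≤
-ξ_{j-1} - ρ_j. -/

theorem arcA_neg (x c φ : ℝ) : arcA x c (-φ) = -arcA x c φ := by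
  simp only [arcA, Real.sin_neg, Real.cos_neg, neg_sq, mul_neg, neg_div]

/-- Keeps the denominator of `arcA` nonnegative even for obtuse angles. -/
theorem abs_cos_le_sqrt {x c : ℝ} (hx : |x| ≤ c) (φ : ℝ) :
    |c * Real.cos φ| ≤ Real.sqrt (c ^ 2 - x ^ 2 * Real.sin φ ^ 2) := by
  apply Real.abs_le_sqrt
  have h : x ^ 2 ≤ c ^ 2 := sq_le_sq' (abs_le.1 hx).1 (abs_le.1 hx).2
  have h' := Real.sin_sq_add_cos_sq φ
  nlinarith [sq_nonneg (Real.sin φ), mul_le_mul_of_nonneg_right h (sq_nonneg (Real.sin φ))]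

theorem arcA_nonneg {x c φ : ℝ} (hx : |x| ≤ c) (h0 : 0 ≤ φ) (h1 : φ ≤ Real.pi) :
    0 ≤ arcA x c φ := by
  have h : x ^ 2 ≤ c ^ 2 := sq_le_sq' (abs_le.1 hx).1 (abs_le.1 hx).2
  have h2 := abs_cos_le_sqrt hx φ
  have h3 := neg_abs_le (c * Real.cos φ)
  exact div_nonneg (mul_nonneg (by linarith) (Real.sin_nonneg_of_nonneg_of_le_pi h0 h1))
    (by linarith)

/-- Cancelling sin φ leaves u / (p + √(p² + u)) with u = c² - x² and p = c cot φ. The cotangent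
decreases on (0, π), and p + √(p² + u) increases with p. -/
theorem arcA_le_arcA_of_pos {x c φ ψ : ℝ} (hc : 0 < c) (hx : |x| ≤ c) (h0 : 0 < φ) (hle : φ ≤ ψ)
    (h1 : ψ < Real.pi) : arcA x c φ ≤ arcA x c ψ := by
  have h : x ^ 2 ≤ c ^ 2 := sq_le_sq' (abs_le.1 hx).1 (abs_le.1 hx).2
  rcases h.eq_or_lt with h | h
  · simp [arcA, h]
  set u := c ^ 2 - x ^ 2 with hu
  have hu0 : 0 < u := by linarith
  have key : ∀ χ, 0 < χ → χ < Real.pi → 0 < c * (Real.cos χ / Real.sin χ) +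
      Real.sqrt ((c * (Real.cos χ / Real.sin χ)) ^ 2 + u) ∧ arcA x c χ =
      u / (c * (Real.cos χ / Real.sin χ) + Real.sqrt ((c * (Real.cos χ / Real.sin χ)) ^ 2 + u)) := by
    intro χ hχ hχ'
    have hs := Real.sin_pos_of_pos_of_lt_pi hχ hχ'
    set p := c * (Real.cos χ / Real.sin χ) with hp
    have hpos : 0 < p + Real.sqrt (p ^ 2 + u) := by
      have : |p| < Real.sqrt (p ^ 2 + u) := by
        rw [Real.lt_sqrt (abs_nonneg _), sq_abs]; linarith
      linarith [neg_abs_le p]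
    refine ⟨hpos, ?_⟩
    have e1 : c * Real.cos χ = p * Real.sin χ := by rw [hp]; field_simp
    have e2 : Real.sqrt (c ^ 2 - x ^ 2 * Real.sin χ ^ 2) =
        Real.sqrt (p ^ 2 + u) * Real.sin χ := by
      rw [← Real.sqrt_sq hs.le, ← Real.sqrt_mul (by positivity), Real.sqrt_sq hs.le]
      congr 1
      have h3 : p ^ 2 * Real.sin χ ^ 2 = c ^ 2 * Real.cos χ ^ 2 := by
        rw [← mul_pow, ← e1, mul_pow]
      rw [add_mul, h3, Real.cos_sq', hu]; ring
    rw [arcA, e1, e2, ← add_mul, ← hu]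
    field_simp
  obtain ⟨_, e1⟩ := key φ h0 (hle.trans_lt h1)
  obtain ⟨p2, e2⟩ := key ψ (h0.trans_le hle) h1
  rw [e1, e2]
  apply div_le_div_of_nonneg_left hu0.le p2
  have hs1 := Real.sin_pos_of_pos_of_lt_pi h0 (hle.trans_lt h1)
  have hs2 := Real.sin_pos_of_pos_of_lt_pi (h0.trans_le hle) h1
  have hcot : c * (Real.cos ψ / Real.sin ψ) ≤ c * (Real.cos φ / Real.sin φ) := by
    apply mul_le_mul_of_nonneg_left _ hc.le
    rw [div_le_div_iff₀ hs2 hs1]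
    have := Real.sin_nonneg_of_nonneg_of_le_pi (sub_nonneg.2 hle) (by linarith)
    rw [Real.sin_sub] at this
    linarith
  have hmono : ∀ p q : ℝ, p ≤ q → p + Real.sqrt (p ^ 2 + u) ≤ q + Real.sqrt (q ^ 2 + u) := by
    intro p q hpq
    have h1 : Real.sqrt (p ^ 2 + u) ≤ Real.sqrt (q ^ 2 + u) + (q - p) := by
      rw [Real.sqrt_le_left (by positivity)]
      have h2 : |q| ≤ Real.sqrt (q ^ 2 + u) := Real.abs_le_sqrt (by linarith)
      have h3 := Real.sq_sqrt (show 0 ≤ q ^ 2 + u by positivity)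
      nlinarith [mul_nonneg (sub_nonneg.2 hpq)
        (show 0 ≤ Real.sqrt (q ^ 2 + u) + q by linarith [neg_abs_le q])]
    linarith
  exact hmono _ _ hcot

theorem arcA_mono {x c φ ψ : ℝ} (hc : 0 < c) (hx : |x| ≤ c) (h0 : -Real.pi < φ) (hle : φ ≤ ψ)
    (h1 : ψ < Real.pi) : arcA x c φ ≤ arcA x c ψ := by
  rcases le_or_gt φ 0 with hφ | hφ
  · rcases le_or_gt 0 ψ with hψ | hψ
    · have h2 := arcA_nonneg hx hψ h1.le
      have h3 := arcA_nonneg hx (neg_nonneg.2 hφ) (by linarith)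
      rw [arcA_neg] at h3
      linarith
    · have h2 := arcA_le_arcA_of_pos hc hx (neg_pos.2 hψ) (neg_le_neg hle) (by linarith)
      rw [arcA_neg, arcA_neg] at h2
      linarith
  · exact arcA_le_arcA_of_pos hc hx hφ hle h1

/-- Rationalizes the denominator; this is the form that gets differentiated. With cos φ < 0 it would
fail at x = ±c, where `arcA` is 0 by division by zero. -/
theorem arcA_eq {x c φ : ℝ} (hc : 0 < c) (hx : |x| ≤ c) (hcos : 0 ≤ Real.cos φ)
    (hsin : Real.sin φ ≠ 0) :
    arcA x c φ =
      (Real.sqrt (c ^ 2 - x ^ 2 * Real.sin φ ^ 2) - c * Real.cos φ) / Real.sin φ := by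
  have h : x ^ 2 ≤ c ^ 2 := sq_le_sq' (abs_le.1 hx).1 (abs_le.1 hx).2
  have h1 := Real.sin_sq_add_cos_sq φ
  have hnn : 0 ≤ c ^ 2 - x ^ 2 * Real.sin φ ^ 2 := by
    nlinarith [sq_nonneg (Real.sin φ), mul_le_mul_of_nonneg_right h (sq_nonneg (Real.sin φ)),
      mul_nonneg (sq_nonneg c) (sq_nonneg (Real.cos φ))]
  have hw := Real.sq_sqrt hnn
  have hw0 := Real.sqrt_nonneg (c ^ 2 - x ^ 2 * Real.sin φ ^ 2)
  set w := Real.sqrt (c ^ 2 - x ^ 2 * Real.sin φ ^ 2)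
  have hcc : 0 ≤ c * Real.cos φ := mul_nonneg hc.le hcos
  rw [arcA]
  rcases (add_nonneg hcc hw0).eq_or_lt with h2 | h2
  -- The denominator vanishes only for φ orthogonal to the chord and x = ±c; both sides are then 0.
  · have h3 : w = 0 := by linarith
    have h4 : c * Real.cos φ = 0 := by linarith
    change _ / (c * Real.cos φ + w) = (w - c * Real.cos φ) / _
    rw [h3, h4]; simp
  · rw [div_eq_div_iff h2.ne' hsin]
    linear_combination -hw + c ^ 2 * h1

/-! ### A segment of the curve in the coordinates of its chord -/

/-- An arc of nondecreasing curvature over the chord `[-c, c]` of the `x`-axis, one-to-one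
projectable onto this chord, with the tangent angle in `[-π/2, π/2]`. -/
structure IsSpiralOver (x y θ k : ℝ → ℝ) (a b c : ℝ) : Prop where
  lt : a < b
  pos : 0 < c
  derivX : ∀ s ∈ Set.Icc a b, HasDerivWithinAt x (Real.cos (θ s)) (Set.Icc a b) s
  derivY : ∀ s ∈ Set.Icc a b, HasDerivWithinAt y (Real.sin (θ s)) (Set.Icc a b) s
  integrable : IntervalIntegrable k MeasureTheory.volume a b
  angle : ∀ s ∈ Set.Icc a b, θ s = θ a + ∫ u in a..s, k u
  range : ∀ s ∈ Set.Icc a b, θ s ∈ Set.Icc (-(Real.pi / 2)) (Real.pi / 2)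
  monoX : StrictMonoOn x (Set.Icc a b)
  startX : x a = -c
  endX : x b = c
  startY : y a = 0
  endY : y b = 0
  mono : MonotoneOn k (Set.Icc a b)

namespace IsSpiralOver

variable {x y θ k : ℝ → ℝ} {a b c : ℝ}

/-- The same arc traversed backwards and rotated by `π`. -/
theorem reverse (h : IsSpiralOver x y θ k a b c) :
    IsSpiralOver (fun s => -x (a + b - s)) (fun s => -y (a + b - s)) (fun s => θ (a + b - s))
      (fun s => -k (a + b - s)) a b c := by
  have hmem : ∀ s ∈ Set.Icc a b, a + b - s ∈ Set.Icc a b := fun s hs =>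
    ⟨by linarith [hs.2], by linarith [hs.1]⟩
  have hsub : ∀ s, HasDerivWithinAt (fun s : ℝ => a + b - s) (-1) (Set.Icc a b) s := fun s =>
    (hasDerivWithinAt_id s _).const_sub (a + b)
  refine ⟨h.lt, h.pos, fun s hs => ?_, fun s hs => ?_, ?_, fun s hs => ?_,
    fun s hs => h.range _ (hmem s hs), ?_, by simp [h.endX], by simp [h.startX],
    by simp [h.endY], by simp [h.startY], ?_⟩
  · exact ((h.derivX _ (hmem s hs)).comp s (hsub s) hmem).neg.congr_deriv (by ring)
  · exact ((h.derivY _ (hmem s hs)).comp s (hsub s) hmem).neg.congr_deriv (by ring)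
  · have := (h.integrable.comp_sub_left (a + b)).symm.neg
    simp only [add_sub_cancel_left, add_sub_cancel_right] at this
    exact this
  · have h1 := h.angle _ (hmem s hs)
    have h2 := h.angle b (Set.right_mem_Icc.2 h.lt.le)
    have hi : ∀ s ∈ Set.Icc a b, IntervalIntegrable k MeasureTheory.volume a s := fun s hs =>
      h.integrable.mono_set (by
        rw [Set.uIcc_of_le h.lt.le, Set.uIcc_of_le hs.1]; exact Set.Icc_subset_Icc_right hs.2)
    have h3 := intervalIntegral.integral_interval_sub_left (hi b (Set.right_mem_Icc.2 h.lt.le))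
      (hi _ (hmem s hs))
    simp only [intervalIntegral.integral_neg, intervalIntegral.integral_comp_sub_left,
      add_sub_cancel_left]
    linarith
  · intro s hs s' hs' hss
    exact neg_lt_neg (h.monoX (hmem _ hs') (hmem _ hs) (by linarith))
  · intro s hs s' hs' hss
    exact neg_le_neg (h.mono (hmem _ hs') (hmem _ hs) (by linarith))

theorem continuousOn_angle (h : IsSpiralOver x y θ k a b c) : ContinuousOn θ (Set.Icc a b) := by
  have h1 : ContinuousOn (fun s => θ a + ∫ u in a..s, k u) (Set.Icc a b) := by
    have := intervalIntegral.continuousOn_primitive_interval' h.integrable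
      (Set.left_mem_uIcc (a := a) (b := b))
    rw [Set.uIcc_of_le h.lt.le] at this
    exact continuousOn_const.add this
  exact h1.congr h.angle

theorem cos_nonneg (h : IsSpiralOver x y θ k a b c) {s : ℝ} (hs : s ∈ Set.Icc a b) :
    0 ≤ Real.cos (θ s) :=
  Real.cos_nonneg_of_neg_pi_div_two_le_of_le (h.range s hs).1 (h.range s hs).2

theorem continuousOn_x (h : IsSpiralOver x y θ k a b c) : ContinuousOn x (Set.Icc a b) :=
  fun s hs => (h.derivX s hs).continuousWithinAt

theorem continuousOn_y (h : IsSpiralOver x y θ k a b c) : ContinuousOn y (Set.Icc a b) :=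
  fun s hs => (h.derivY s hs).continuousWithinAt

theorem intervalIntegrable_cos_mul (h : IsSpiralOver x y θ k a b c) (κ : ℝ) {s s' : ℝ}
    (hs : s ∈ Set.Icc a b) (hs' : s' ∈ Set.Icc a b) :
    IntervalIntegrable (fun u => Real.cos (θ u) * (k u - κ)) MeasureTheory.volume s s' := by
  have hss : Set.uIcc s s' ⊆ Set.Icc a b := Set.uIcc_subset_Icc hs hs'
  refine IntervalIntegrable.continuousOn_mul ?_
    (Real.continuous_cos.comp_continuousOn (h.continuousOn_angle.mono hss))
  refine (h.integrable.mono_set ?_).sub intervalIntegrable_const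
  rwa [Set.uIcc_of_le h.lt.le]

/-- With respect to the abscissa, the sine of the tangent angle is a primitive of the
curvature. -/
theorem integral_cos_mul (h : IsSpiralOver x y θ k a b c) (κ : ℝ) {s s' : ℝ}
    (hs : s ∈ Set.Icc a b) (hs' : s' ∈ Set.Icc a b) (hle : s ≤ s') :
    ∫ u in s..s', Real.cos (θ u) * (k u - κ) =
      (Real.sin (θ s') - κ * x s') - (Real.sin (θ s) - κ * x s) := by
  have hss : Set.Icc s s' ⊆ Set.Icc a b := Set.Icc_subset_Icc hs.1 hs'.2
  -- Being monotone, k has at most countably many discontinuities, and elsewhere θ' = k.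
  refine MeasureTheory.integral_eq_of_hasDerivAt_off_countable_of_le
    (fun u => Real.sin (θ u) - κ * x u) _ hle h.mono.countable_not_continuousWithinAt ?_ ?_
    (h.intervalIntegrable_cos_mul κ hs hs')
  · exact (Real.continuous_sin.comp_continuousOn (h.continuousOn_angle.mono hss)).sub
      (continuousOn_const.mul (h.continuousOn_x.mono hss))
  · rintro u ⟨hu, hu'⟩
    have huI : u ∈ Set.Icc a b := hss ⟨hu.1.le, hu.2.le⟩
    have hnhds : Set.Icc a b ∈ nhds u :=
      Icc_mem_nhds (hs.1.trans_lt hu.1) (hu.2.trans_le hs'.2)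
    have hk : ContinuousAt k u := by
      by_contra hcon
      exact hu' ⟨huI, fun hcw => hcon (hcw.continuousAt hnhds)⟩
    have hint : IntervalIntegrable k MeasureTheory.volume a u := h.integrable.mono_set (by
      rw [Set.uIcc_of_le h.lt.le, Set.uIcc_of_le huI.1]; exact Set.Icc_subset_Icc_right huI.2)
    have hmeas : StronglyMeasurableAtFilter k (nhds u) :=
      ⟨Set.Ioc a b, Ioc_mem_nhds (hs.1.trans_lt hu.1) (hu.2.trans_le hs'.2),
        h.integrable.1.aestronglyMeasurable⟩
    have hθ : HasDerivAt θ (k u) u := by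
      have := (intervalIntegral.integral_hasDerivAt_right hint hmeas hk).const_add (θ a)
      exact this.congr_of_eventuallyEq (Filter.eventuallyEq_of_mem hnhds h.angle)
    exact (hθ.sin.sub (((h.derivX u huI).hasDerivAt hnhds).const_mul κ)).congr_deriv (by ring)

theorem abs_x_le (h : IsSpiralOver x y θ k a b c) {s : ℝ} (hs : s ∈ Set.Icc a b) : |x s| ≤ c := by
  rw [abs_le, ← h.startX, ← h.endX]
  exact ⟨h.monoX.monotoneOn (Set.left_mem_Icc.2 h.lt.le) hs hs.1,
    h.monoX.monotoneOn hs (Set.right_mem_Icc.2 h.lt.le) hs.2⟩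

theorem abs_x_lt (h : IsSpiralOver x y θ k a b c) {s : ℝ} (hs : s ∈ Set.Ioo a b) : |x s| < c := by
  rw [abs_lt, ← h.startX, ← h.endX]
  have hs' : s ∈ Set.Icc a b := ⟨hs.1.le, hs.2.le⟩
  exact ⟨h.monoX (Set.left_mem_Icc.2 h.lt.le) hs' hs.1,
    h.monoX hs' (Set.right_mem_Icc.2 h.lt.le) hs.2⟩

/-! ### Height of the segment over a circular arc -/

/-- The derivative of the height over the circular arc with the same start tangent. -/
def heightDeriv (x θ : ℝ → ℝ) (a c s : ℝ) : ℝ :=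
  Real.sin (θ s) + x s * Real.sin (θ a) * Real.cos (θ s) /
    Real.sqrt (c ^ 2 - x s ^ 2 * Real.sin (θ a) ^ 2)

/-- Only inside the segment: at its ends the radicand is c² cos² θ(a), which is 0 for a start
tangent orthogonal to the chord. -/
theorem radicand_pos (h : IsSpiralOver x y θ k a b c) {s : ℝ} (hs : s ∈ Set.Ioo a b) :
    0 < c ^ 2 - x s ^ 2 * Real.sin (θ a) ^ 2 := by
  have h1 : x s ^ 2 < c ^ 2 := sq_lt_sq' (abs_lt.1 (h.abs_x_lt hs)).1 (abs_lt.1 (h.abs_x_lt hs)).2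
  nlinarith [Real.sin_sq_le_one (θ a), sq_nonneg (x s)]

theorem continuousOn_height (h : IsSpiralOver x y θ k a b c) :
    ContinuousOn (fun s => y s - arcA (x s) c (θ a)) (Set.Icc a b) := by
  have ha := Set.left_mem_Icc.2 h.lt.le
  refine h.continuousOn_y.sub ?_
  by_cases h0 : Real.sin (θ a) = 0
  · simp only [arcA, h0, mul_zero, zero_div]; exact continuousOn_const
  · have hx := h.continuousOn_x
    refine ContinuousOn.congr (f := fun s => (Real.sqrt (c ^ 2 - x s ^ 2 * Real.sin (θ a) ^ 2)
      - c * Real.cos (θ a)) / Real.sin (θ a)) (by fun_prop) fun s hs => ?_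
    exact arcA_eq h.pos (h.abs_x_le hs) (h.cos_nonneg ha) h0

theorem hasDerivAt_height (h : IsSpiralOver x y θ k a b c) {s : ℝ} (hs : s ∈ Set.Ioo a b) :
    HasDerivAt (fun s => y s - arcA (x s) c (θ a)) (heightDeriv x θ a c s) s := by
  have ha := Set.left_mem_Icc.2 h.lt.le
  have hsI : s ∈ Set.Icc a b := ⟨hs.1.le, hs.2.le⟩
  have hn : Set.Icc a b ∈ nhds s := Icc_mem_nhds hs.1 hs.2
  have hy := (h.derivY s hsI).hasDerivAt hn
  have hx := (h.derivX s hsI).hasDerivAt hn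
  by_cases h0 : Real.sin (θ a) = 0
  · simp only [arcA, heightDeriv, h0, mul_zero, zero_div, sub_zero, zero_mul, add_zero]
    exact hy
  · have hp := h.radicand_pos hs
    have hd := ((((hx.pow 2).mul_const (Real.sin (θ a) ^ 2)).const_sub (c ^ 2)).sqrt hp.ne'
      |>.sub_const (c * Real.cos (θ a))).div_const (Real.sin (θ a))
    have hd' : HasDerivAt (fun s => arcA (x s) c (θ a)) _ s :=
      hd.congr_of_eventuallyEq (Filter.eventuallyEq_of_mem hn fun u hu =>
        arcA_eq h.pos (h.abs_x_le hu) (h.cos_nonneg ha) h0)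
    refine (hy.sub hd').congr_deriv ?_
    have := (Real.sqrt_pos.2 hp).ne'
    simp only [heightDeriv, Nat.cast_ofNat, Pi.pow_apply]
    field_simp
    ring

/-- The sign of `heightDeriv` is that of the difference of the sines of the tangent angles. -/
theorem heightDeriv_eq (h : IsSpiralOver x y θ k a b c) {s : ℝ} (hs : s ∈ Set.Ioo a b) :
    ∃ ω ∈ Set.Ioo (-(Real.pi / 2)) (Real.pi / 2), ∃ r > 0,
      Real.sin ω = -(Real.sin (θ a) / c) * x s ∧
      heightDeriv x θ a c s = r * Real.sin (θ s - ω) := by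
  have hc := h.pos
  have hp := h.radicand_pos hs
  have hw := Real.sqrt_pos.2 hp
  -- S = κx is the sine of the tangent angle ω of the arc at abscissa x, and the factor r is 1 / cos
  -- ω.
  set S := -(Real.sin (θ a) / c) * x s with hS
  have hS1 : 1 - S ^ 2 = (c ^ 2 - x s ^ 2 * Real.sin (θ a) ^ 2) / c ^ 2 := by
    rw [hS]; field_simp
  have hS2 : S ^ 2 < 1 := by
    have : 0 < 1 - S ^ 2 := by rw [hS1]; positivity
    linarith
  have hS3 := abs_lt.1 ((sq_lt_one_iff_abs_lt_one S).1 hS2)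
  have hsq : Real.sqrt (1 - S ^ 2) = Real.sqrt (c ^ 2 - x s ^ 2 * Real.sin (θ a) ^ 2) / c := by
    rw [hS1, Real.sqrt_div hp.le, Real.sqrt_sq hc.le]
  refine ⟨Real.arcsin S, ⟨Real.neg_pi_div_two_lt_arcsin.2 hS3.1,
    Real.arcsin_lt_pi_div_two.2 hS3.2⟩, c / Real.sqrt (c ^ 2 - x s ^ 2 * Real.sin (θ a) ^ 2),
    by positivity, Real.sin_arcsin hS3.1.le hS3.2.le, ?_⟩
  rw [Real.sin_sub, Real.cos_arcsin, hsq, Real.sin_arcsin hS3.1.le hS3.2.le, heightDeriv, hS]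
  field_simp
  ring

/-- As θ and ω lie in [-π/2, π/2], ω strictly inside, sin(θ - ω) and sin θ - sin ω have the same
sign. The next two lemmas rest on this too. -/
theorem pos_of_heightDeriv_pos (h : IsSpiralOver x y θ k a b c) {s : ℝ} (hs : s ∈ Set.Ioo a b)
    (hd : 0 < heightDeriv x θ a c s) : 0 < Real.sin (θ s) - -(Real.sin (θ a) / c) * x s := by
  obtain ⟨ω, hω, r, hr, e1, e2⟩ := h.heightDeriv_eq hs
  have hθ := h.range s ⟨hs.1.le, hs.2.le⟩
  rw [← e1, sub_pos]
  rw [e2] at hd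
  apply Real.strictMonoOn_sin ⟨hω.1.le, hω.2.le⟩ hθ
  by_contra hcon
  have := Real.sin_nonpos_of_nonpos_of_neg_pi_le (x := θ s - ω) (by linarith)
    (by linarith [hθ.1, hω.2])
  exact absurd hd (not_lt.2 (mul_nonpos_of_nonneg_of_nonpos hr.le this))

theorem neg_of_heightDeriv_neg (h : IsSpiralOver x y θ k a b c) {s : ℝ} (hs : s ∈ Set.Ioo a b)
    (hd : heightDeriv x θ a c s < 0) : Real.sin (θ s) - -(Real.sin (θ a) / c) * x s < 0 := by
  obtain ⟨ω, hω, r, hr, e1, e2⟩ := h.heightDeriv_eq hs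
  have hθ := h.range s ⟨hs.1.le, hs.2.le⟩
  rw [← e1, sub_neg]
  rw [e2] at hd
  apply Real.strictMonoOn_sin hθ ⟨hω.1.le, hω.2.le⟩
  by_contra hcon
  have := Real.sin_nonneg_of_nonneg_of_le_pi (x := θ s - ω) (by linarith)
    (by linarith [hθ.2, hω.1])
  exact absurd hd (not_lt.2 (mul_nonneg hr.le this))

theorem eq_zero_of_heightDeriv_eq_zero (h : IsSpiralOver x y θ k a b c) {s : ℝ}
    (hs : s ∈ Set.Ioo a b) (hd : heightDeriv x θ a c s = 0) :
    Real.sin (θ s) - -(Real.sin (θ a) / c) * x s = 0 := by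
  obtain ⟨ω, hω, r, hr, e1, e2⟩ := h.heightDeriv_eq hs
  have hθ := h.range s ⟨hs.1.le, hs.2.le⟩
  rw [e2, mul_eq_zero] at hd
  have h0 := (Real.sin_eq_zero_iff_of_lt_of_lt (x := θ s - ω)
    (by linarith [hθ.1, hω.2]) (by linarith [hθ.2, hω.1])).1 (hd.resolve_left hr.ne')
  rw [← e1, sub_eq_zero.1 h0, sub_self]

theorem height_start (h : IsSpiralOver x y θ k a b c) : y a - arcA (x a) c (θ a) = 0 := by
  simp [arcA, h.startX, h.startY]

theorem height_end (h : IsSpiralOver x y θ k a b c) : y b - arcA (x b) c (θ a) = 0 := by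
  simp [arcA, h.endX, h.endY]

theorem slope_start (h : IsSpiralOver x y θ k a b c) :
    Real.sin (θ a) - -(Real.sin (θ a) / c) * x a = 0 := by
  have := h.pos
  rw [h.startX]; field_simp; ring

/-- The segment lies below the circular arc with the same start tangent. -/
theorem y_le_arcA (h : IsSpiralOver x y θ k a b c) {s : ℝ} (hs : s ∈ Set.Icc a b) :
    y s ≤ arcA (x s) c (θ a) := by
  by_contra! hcon
  have ha := Set.left_mem_Icc.2 h.lt.le
  have hb := Set.right_mem_Icc.2 h.lt.le
  have has : a < s := lt_of_le_of_ne hs.1 (by rintro rfl; linarith [h.height_start])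
  have hsb : s < b := lt_of_le_of_ne hs.2 (by rintro rfl; linarith [h.height_end])
  -- A positive height at s, with height 0 at both ends, forces a rise at some s₁ before s and a
  -- fall at some s₂ after it.
  obtain ⟨s₁, h1, e1⟩ := exists_hasDerivAt_eq_slope (fun s => y s - arcA (x s) c (θ a))
    (heightDeriv x θ a c) has (h.continuousOn_height.mono (Set.Icc_subset_Icc_right hs.2))
    fun u hu => h.hasDerivAt_height ⟨hu.1, hu.2.trans hsb⟩
  obtain ⟨s₂, h2, e2⟩ := exists_hasDerivAt_eq_slope (fun s => y s - arcA (x s) c (θ a))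
    (heightDeriv x θ a c) hsb (h.continuousOn_height.mono (Set.Icc_subset_Icc_left hs.1))
    fun u hu => h.hasDerivAt_height ⟨has.trans hu.1, hu.2⟩
  have i1 : s₁ ∈ Set.Ioo a b := ⟨h1.1, h1.2.trans hsb⟩
  have i2 : s₂ ∈ Set.Ioo a b := ⟨has.trans h2.1, h2.2⟩
  have I1 : s₁ ∈ Set.Icc a b := ⟨i1.1.le, i1.2.le⟩
  have I2 : s₂ ∈ Set.Icc a b := ⟨i2.1.le, i2.2.le⟩
  have p1 := h.pos_of_heightDeriv_pos i1 (by
    rw [e1, h.height_start]; apply div_pos <;> linarith)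
  have p2 := h.neg_of_heightDeriv_neg i2 (by
    rw [e2, h.height_end]; apply div_neg_of_neg_of_pos <;> linarith)
  set κ := -(Real.sin (θ a) / c) with hκ
  -- sin θ - κx goes from 0 at a to a positive value at s₁, so k > κ somewhere on the way, hence on
  -- all of [s₁, s₂]; it then cannot become negative at s₂.
  have hk : ∃ u ∈ Set.Icc a s₁, κ < k u := by
    by_contra! hle
    have := h.integral_cos_mul κ ha I1 I1.1
    have h3 : 0 ≤ ∫ u in a..s₁, -(Real.cos (θ u) * (k u - κ)) :=
      intervalIntegral.integral_nonneg I1.1 fun u hu => by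
        have := mul_nonneg (h.cos_nonneg ⟨hu.1, hu.2.trans I1.2⟩) (sub_nonneg.2 (hle u hu))
        linarith
    rw [intervalIntegral.integral_neg] at h3
    linarith [h.slope_start]
  obtain ⟨u, hu, hku⟩ := hk
  have h12 : s₁ ≤ s₂ := (h1.2.trans h2.1).le
  have := h.integral_cos_mul κ I1 I2 h12
  have h3 : 0 ≤ ∫ u in s₁..s₂, Real.cos (θ u) * (k u - κ) :=
    intervalIntegral.integral_nonneg h12 fun v hv => by
      have hv' : v ∈ Set.Icc a b := ⟨I1.1.trans hv.1, hv.2.trans I2.2⟩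
      have := h.mono ⟨hu.1, hu.2.trans I1.2⟩ hv' (hu.2.trans hv.1)
      exact mul_nonneg (h.cos_nonneg hv') (by linarith)
  linarith

/-- The curvature at the start does not exceed that of the circular arc with the same start
tangent. -/
theorem curvature_start_le (h : IsSpiralOver x y θ k a b c) : k a * c ≤ -Real.sin (θ a) := by
  by_contra! hcon
  have hc := h.pos
  have ha := Set.left_mem_Icc.2 h.lt.le
  have hκ : -(Real.sin (θ a) / c) < k a := by
    rw [← neg_div, div_lt_iff₀ hc]; exact hcon
  obtain ⟨s, hs, e⟩ := exists_hasDerivAt_eq_zero h.lt h.continuousOn_height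
    (h.height_start.trans h.height_end.symm) fun u hu => h.hasDerivAt_height hu
  have hsI : s ∈ Set.Icc a b := ⟨hs.1.le, hs.2.le⟩
  have h0 := h.eq_zero_of_heightDeriv_eq_zero hs e
  -- Subtracting k(a) instead of κ makes the integrand nonnegative; the integral equals (κ - k(a))
  -- (x(s) - x(a)), which is negative.
  have h1 := h.integral_cos_mul (k a) ha hsI hs.1.le
  have h2 : 0 ≤ ∫ u in a..s, Real.cos (θ u) * (k u - k a) :=
    intervalIntegral.integral_nonneg hs.1.le fun v hv => by
      have hv' : v ∈ Set.Icc a b := ⟨hv.1, hv.2.trans hsI.2⟩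
      exact mul_nonneg (h.cos_nonneg hv') (sub_nonneg.2 (h.mono ha hv' hv.1))
  have h3 := h.monoX ha hsI hs.1
  have h4 := h.slope_start
  nlinarith [mul_pos (sub_pos.2 hκ) (sub_pos.2 h3)]

/-- The segment lies above the circular arc with the same end tangent. -/
theorem arcA_le_y (h : IsSpiralOver x y θ k a b c) {s : ℝ} (hs : s ∈ Set.Icc a b) :
    arcA (x s) c (-θ b) ≤ y s := by
  have := h.reverse.y_le_arcA (s := a + b - s) ⟨by linarith [hs.2], by linarith [hs.1]⟩
  simp only [sub_sub_cancel, add_sub_cancel_left] at this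
  have e : arcA (-x s) c (θ b) = arcA (x s) c (θ b) := by simp [arcA]
  rw [e] at this
  rw [arcA_neg]
  linarith

theorem le_curvature_end (h : IsSpiralOver x y θ k a b c) : Real.sin (θ b) ≤ k b * c := by
  have := h.reverse.curvature_start_le
  simp only [add_sub_cancel_left] at this
  linarith

/-- Vogt's theorem for a projectable arc. -/
theorem add_nonneg_angle (h : IsSpiralOver x y θ k a b c) : 0 ≤ θ a + θ b := by
  have hc := h.pos
  -- The two bounding arcs are compared at x = 0, where an arc of angle φ has height c tan(φ/2).
  obtain ⟨s, hs, hs0⟩ : (0 : ℝ) ∈ x '' Set.Icc a b :=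
    intermediate_value_Icc h.lt.le h.continuousOn_x
      ⟨by rw [h.startX]; linarith, by rw [h.endX]; exact hc.le⟩
  have h1 := (h.arcA_le_y hs).trans (h.y_le_arcA hs)
  have ra := h.range a (Set.left_mem_Icc.2 h.lt.le)
  have rb := h.range b (Set.right_mem_Icc.2 h.lt.le)
  have pc : ∀ φ, 0 ≤ Real.cos φ → 0 < 1 + Real.cos φ := fun φ h => by linarith
  have ca := pc _ (h.cos_nonneg (Set.left_mem_Icc.2 h.lt.le))
  have cb := pc _ (h.cos_nonneg (Set.right_mem_Icc.2 h.lt.le))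
  have e : ∀ φ, arcA 0 c φ = c * (Real.sin φ / (1 + Real.cos φ)) := fun φ => by
    simp only [arcA, ne_eq, OfNat.ofNat_ne_zero, not_false_eq_true, zero_pow, zero_mul, sub_zero,
      Real.sqrt_sq hc.le]
    rw [show c * Real.cos φ + c = c * (1 + Real.cos φ) by ring, ← mul_div_assoc, sq, mul_assoc,
      mul_div_mul_left _ _ hc.ne']
  rw [hs0, e, e, Real.sin_neg, Real.cos_neg, mul_le_mul_iff_right₀ hc,
    div_le_div_iff₀ cb ca] at h1
  by_contra! hcon
  have hpi := Real.pi_pos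
  -- The comparison amounts to sin θ(a) + sin θ(b) + sin(θ(a) + θ(b)) ≥ 0. The sum -π is set apart
  -- because the last sine vanishes there.
  have h2 : Real.sin (θ a + θ b) < 0 ∨ θ a + θ b = -Real.pi := by
    rcases (show -Real.pi ≤ θ a + θ b by linarith [ra.1, rb.1]).eq_or_lt with h | h
    · exact Or.inr h.symm
    · exact Or.inl (Real.sin_neg_of_neg_of_neg_pi_lt hcon h)
  rcases h2 with h2 | h2
  · rw [Real.sin_add] at h2
    have h3 : Real.sin (θ a) + Real.sin (θ b) < 0 := by
      have e1 : Real.sin (θ a) + Real.sin (θ b) =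
          2 * Real.sin ((θ a + θ b) / 2) * Real.cos ((θ a - θ b) / 2) := by
        rw [Real.sin_add_sin]
      have : Real.sin ((θ a + θ b) / 2) < 0 :=
        Real.sin_neg_of_neg_of_neg_pi_lt (by linarith) (by linarith [ra.1, rb.1])
      have h5 : 0 < Real.cos ((θ a - θ b) / 2) := Real.cos_pos_of_mem_Ioo
        ⟨by linarith [ra.1, rb.2], by linarith [ra.2, rb.1]⟩
      rw [e1]; nlinarith [mul_pos (neg_pos.2 this) h5]
    nlinarith
  · have e1 : θ a = -(Real.pi / 2) := by linarith [ra.1, rb.1]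
    have e2 : θ b = -(Real.pi / 2) := by linarith [ra.1, rb.1]
    rw [e1, e2] at h1
    simp at h1
    linarith

end IsSpiralOver

/-! ### Local coordinates on a chord -/

theorem nvec_re (φ : ℝ) : (nvec φ).re = Real.cos φ := Complex.exp_ofReal_mul_I_re φ

theorem nvec_im (φ : ℝ) : (nvec φ).im = Real.sin φ := Complex.exp_ofReal_mul_I_im φ

theorem nvec_mul (φ ψ : ℝ) : nvec φ * nvec ψ = nvec (φ + ψ) := by
  simp only [nvec, ← Complex.exp_add, Complex.ofReal_add, add_mul]

theorem coe_eq_coe_of_nvec_eq {φ ψ : ℝ} (h : nvec φ = nvec ψ) :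
    (φ : Real.Angle) = (ψ : Real.Angle) := by
  apply Real.Angle.cos_sin_inj
  · rw [← nvec_re, ← nvec_re, h]
  · rw [← nvec_im, ← nvec_im, h]

theorem norm_mul_nvec_arg (z : ℂ) : (‖z‖ : ℂ) * nvec (Complex.arg z) = z :=
  Complex.norm_mul_exp_arg_mul_I z

theorem chord_mul_nvec (P : ℤ → ℂ) (j : ℤ) :
    (P (j + 1) - P j) * nvec (-chordDir P j) = ((2 * chordHalf P j : ℝ) : ℂ) := by
  conv_lhs => rw [← norm_mul_nvec_arg (P (j + 1) - P j)]
  rw [mul_assoc, chordDir, nvec_mul, chordHalf, mul_div_cancel₀ _ two_ne_zero]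
  simp [nvec]

theorem localCoord_start (P : ℤ → ℂ) (j : ℤ) :
    localCoord P j (P j) = ((-chordHalf P j : ℝ) : ℂ) := by
  have h := chord_mul_nvec P j
  push_cast at h ⊢
  rw [localCoord]
  linear_combination (-1 / 2 : ℂ) * h

theorem localCoord_end (P : ℤ → ℂ) (j : ℤ) :
    localCoord P j (P (j + 1)) = (chordHalf P j : ℂ) := by
  have h := chord_mul_nvec P j
  push_cast at h
  rw [localCoord]
  linear_combination (1 / 2 : ℂ) * h

theorem hasDerivWithinAt_localCoord {γ : ℝ → ℂ} {φ s : ℝ} {S : Set ℝ}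
    (h : HasDerivWithinAt γ (nvec φ) S s) (P : ℤ → ℂ) (j : ℤ) :
    HasDerivWithinAt (fun s => localCoord P j (γ s)) (nvec (φ - chordDir P j)) S s := by
  rw [sub_eq_add_neg, ← nvec_mul]
  exact (h.sub_const _).mul_const _

/-- The tangent angle with respect to the `j`-th chord, reduced to `(-π, π]`. -/
def relAngle (P : ℤ → ℂ) (θ : ℝ → ℝ) (j : ℤ) (s : ℝ) : ℝ :=
  ((θ s - chordDir P j : ℝ) : Real.Angle).toReal

theorem cos_relAngle (P : ℤ → ℂ) (θ : ℝ → ℝ) (j : ℤ) (s : ℝ) :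
    Real.cos (relAngle P θ j s) = Real.cos (θ s - chordDir P j) := by
  rw [relAngle, Real.Angle.cos_toReal, Real.Angle.cos_coe]

theorem sin_relAngle (P : ℤ → ℂ) (θ : ℝ → ℝ) (j : ℤ) (s : ℝ) :
    Real.sin (relAngle P θ j s) = Real.sin (θ s - chordDir P j) := by
  rw [relAngle, Real.Angle.sin_toReal, Real.Angle.sin_coe]

/-- A continuous angle with nonnegative cosine stays in `[-π/2, π/2]`. -/
theorem abs_le_pi_div_two_of_cos_nonneg {F : ℝ → ℝ} {a b : ℝ} (hF : ContinuousOn F (Set.Icc a b))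
    (hcos : ∀ s ∈ Set.Icc a b, 0 ≤ Real.cos (F s)) (ha : |F a| ≤ Real.pi / 2) {s : ℝ}
    (hs : s ∈ Set.Icc a b) : |F s| ≤ Real.pi / 2 := by
  have hpi := Real.pi_pos
  have hG : ContinuousOn (fun u => |F u|) (Set.Icc a s) :=
    (hF.mono (Set.Icc_subset_Icc_right hs.2)).abs
  by_contra! hcon
  -- A value in (π/2, π], where the cosine is negative, that |F| must attain on its way to |F s|.
  set m := min |F s| Real.pi with hm
  have hm1 : Real.pi / 2 < m := lt_min hcon (by linarith)
  obtain ⟨u, hu, e⟩ := intermediate_value_Icc hs.1 hG ⟨ha.trans hm1.le, min_le_left _ _⟩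
  have h1 := hcos u ⟨hu.1, hu.2.trans hs.2⟩
  rw [← Real.cos_abs] at h1
  have h2 : Real.cos |F u| < 0 := by
    change |F u| = m at e
    rw [e]
    exact Real.cos_neg_of_pi_div_two_lt_of_lt hm1 (by linarith [min_le_right |F s| Real.pi])
  linarith

/-- A projectable segment of the curve with `ε k` nondecreasing, where `ε = ±1`, becomes after a
possible reflection an arc of nondecreasing curvature over its chord. -/
theorem isSpiralOver_of_isCurveOn {P : ℤ → ℂ} {γ : ℝ → ℂ} {θ k : ℝ → ℝ} {S : Set ℝ} {j : ℤ}
    {a b ε : ℝ} (hcurve : IsCurveOn γ θ k S) (hsub : Set.Icc a b ⊆ S) (hab : a < b)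
    (ha : γ a = P j) (hb : γ b = P (j + 1)) (hne : P j ≠ P (j + 1))
    (hproj : Set.InjOn (fun s => (localCoord P j (γ s)).re) (Set.Icc a b))
    (hε : ε = 1 ∨ ε = -1) (hmono : MonotoneOn (fun s => ε * k s) (Set.Icc a b)) :
    IsSpiralOver (fun s => (localCoord P j (γ s)).re) (fun s => ε * (localCoord P j (γ s)).im)
      (fun s => ε * relAngle P θ j s) (fun s => ε * k s) a b (chordHalf P j) := by
  have haI := Set.left_mem_Icc.2 hab.le
  have hbI := Set.right_mem_Icc.2 hab.le
  have hc : 0 < chordHalf P j := by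
    rw [chordHalf]; exact div_pos (norm_pos_iff.2 (sub_ne_zero.2 hne.symm)) two_pos
  have hd : ∀ s ∈ Set.Icc a b, HasDerivWithinAt (fun s => localCoord P j (γ s))
      (nvec (θ s - chordDir P j)) (Set.Icc a b) s := fun s hs =>
    hasDerivWithinAt_localCoord ((hcurve.tangent s (hsub hs)).mono hsub) P j
  have hdx : ∀ s ∈ Set.Icc a b, HasDerivWithinAt (fun s => (localCoord P j (γ s)).re)
      (Real.cos (relAngle P θ j s)) (Set.Icc a b) s := fun s hs => by
    rw [cos_relAngle, ← nvec_re]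
    exact Complex.reCLM.hasFDerivAt.comp_hasDerivWithinAt s (hd s hs)
  have hdy : ∀ s ∈ Set.Icc a b, HasDerivWithinAt (fun s => (localCoord P j (γ s)).im)
      (Real.sin (relAngle P θ j s)) (Set.Icc a b) s := fun s hs => by
    rw [sin_relAngle, ← nvec_im]
    exact Complex.imCLM.hasFDerivAt.comp_hasDerivWithinAt s (hd s hs)
  have hxa : (localCoord P j (γ a)).re = -chordHalf P j := by
    rw [ha, localCoord_start, Complex.ofReal_re]
  have hxb : (localCoord P j (γ b)).re = chordHalf P j := by
    rw [hb, localCoord_end, Complex.ofReal_re]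
  have hmonoX : StrictMonoOn (fun s => (localCoord P j (γ s)).re) (Set.Icc a b) :=
    ContinuousOn.strictMonoOn_of_injOn_Icc hab.le (by simp only [hxa, hxb]; linarith)
      (fun s hs => (hdx s hs).continuousWithinAt) hproj
  have hcos : ∀ s ∈ Set.Icc a b, 0 ≤ Real.cos (relAngle P θ j s) := fun s hs =>
    (hdx s hs).nonneg_of_monotoneOn
      (uniqueDiffWithinAt_iff_accPt.1 (uniqueDiffOn_Icc hab s hs)) hmonoX.monotoneOn
  have habs : ∀ s ∈ Set.Icc a b, |relAngle P θ j s| ≤ Real.pi / 2 := fun s hs => by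
    have := hcos s hs
    rw [relAngle, Real.Angle.cos_toReal] at this
    exact Real.Angle.cos_nonneg_iff_abs_toReal_le_pi_div_two.1 this
  have hint : IntervalIntegrable k MeasureTheory.volume a b :=
    hcurve.integrable a (hsub haI) b (hsub hbI)
  -- The reduced angle could jump by 2π. The continuous lift with the same start stays in [-π/2,
  -- π/2], so it coincides with the reduced angle.
  have hcont : ContinuousOn (fun s => relAngle P θ j a + ∫ u in a..s, k u) (Set.Icc a b) := by
    have := intervalIntegral.continuousOn_primitive_interval' hint
      (Set.left_mem_uIcc (a := a) (b := b))
    rw [Set.uIcc_of_le hab.le] at this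
    exact continuousOn_const.add this
  have hcoe : ∀ s ∈ Set.Icc a b, ((relAngle P θ j a + ∫ u in a..s, k u : ℝ) : Real.Angle) =
      ((θ s - chordDir P j : ℝ) : Real.Angle) := fun s hs => by
    rw [← hcurve.curvature a (hsub haI) s (hsub hs), Real.Angle.coe_add, relAngle,
      Real.Angle.coe_toReal, ← Real.Angle.coe_add]
    congr 1; ring
  have hangle : ∀ s ∈ Set.Icc a b,
      relAngle P θ j s = relAngle P θ j a + ∫ u in a..s, k u := fun s hs => by
    have h1 : |relAngle P θ j a + ∫ u in a..s, k u| ≤ Real.pi / 2 :=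
      abs_le_pi_div_two_of_cos_nonneg hcont (fun u hu => by
        rw [← Real.Angle.cos_coe, hcoe u hu, Real.Angle.cos_coe, ← cos_relAngle]
        exact hcos u hu) (by simpa using habs a haI) hs
    rw [abs_le] at h1
    rw [relAngle, ← hcoe s hs, Real.Angle.toReal_coe_eq_self_iff]
    constructor <;> linarith [Real.pi_pos]
  refine ⟨hab, hc, fun s hs => ?_, fun s hs => ?_, hint.const_mul ε, fun s hs => ?_, fun s hs => ?_,
    hmonoX, hxa, hxb, ?_, ?_, hmono⟩
  · refine (hdx s hs).congr_deriv ?_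
    rcases hε with rfl | rfl <;> simp
  · refine ((hdy s hs).const_mul ε).congr_deriv ?_
    rcases hε with rfl | rfl <;> simp
  · simp only [intervalIntegral.integral_const_mul]
    rw [hangle s hs]; ring
  · rw [Set.mem_Icc, ← abs_le, abs_mul]
    rcases hε with rfl | rfl <;> simpa using habs s hs
  · simp only [ha, localCoord_start, Complex.ofReal_im, mul_zero]
  · simp only [hb, localCoord_end, Complex.ofReal_im, mul_zero]

/-! ### Bounds for one chord, for either sense of monotonicity -/

/-- What monotone curvature implies for a segment of the curve over a chord of half-length `c`:
`α`, `β` are the directions of the end tangents with respect to the chord, `k₁`, `k₂` the end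
curvatures, and `Z` is the set of points of the segment. -/
structure SpiralChord (up : Prop) (c α β k₁ k₂ : ℝ) (Z : Set ℂ) : Prop where
  pos : 0 < c
  abs_start : |α| ≤ Real.pi / 2
  abs_end : |β| ≤ Real.pi / 2
  abs_re : ∀ z ∈ Z, |z.re| ≤ c
  first : ∀ z ∈ Z, FirstBound up c (-β) z
  second : ∀ z ∈ Z, SecondBound up c α z
  curv_start : (up → k₁ * c ≤ -Real.sin α) ∧ (¬ up → -Real.sin α ≤ k₁ * c)
  curv_end : (up → Real.sin β ≤ k₂ * c) ∧ (¬ up → k₂ * c ≤ Real.sin β)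
  vogt : (up → 0 ≤ α + β) ∧ (¬ up → α + β ≤ 0)

/-- Reflection in the chord (ε = -1) changes the signs of y, of the angles and of k, so the
nonincreasing case follows with all inequalities reversed. -/
theorem spiralChord_of_isCurveOn {P : ℤ → ℂ} {γ : ℝ → ℂ} {θ k : ℝ → ℝ} {S : Set ℝ} {j : ℤ}
    {a b : ℝ} {up : Prop} (hcurve : IsCurveOn γ θ k S) (hsub : Set.Icc a b ⊆ S) (hab : a < b)
    (ha : γ a = P j) (hb : γ b = P (j + 1)) (hne : P j ≠ P (j + 1))
    (hproj : Set.InjOn (fun s => (localCoord P j (γ s)).re) (Set.Icc a b))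
    (hup : up → MonotoneOn k (Set.Icc a b)) (hdown : ¬ up → AntitoneOn k (Set.Icc a b)) :
    SpiralChord up (chordHalf P j) (relAngle P θ j a) (relAngle P θ j b) (k a) (k b)
      ((fun s => localCoord P j (γ s)) '' Set.Icc a b) := by
  have haI := Set.left_mem_Icc.2 hab.le
  have hbI := Set.right_mem_Icc.2 hab.le
  by_cases h : up
  · have H := isSpiralOver_of_isCurveOn hcurve hsub hab ha hb hne hproj (Or.inl rfl)
      (by simpa using hup h)
    simp only [one_mul] at H
    refine ⟨H.pos, abs_le.2 (H.range a haI), abs_le.2 (H.range b hbI), ?_, ?_, ?_,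
      ⟨fun _ => H.curvature_start_le, fun h' => absurd h h'⟩,
      ⟨fun _ => H.le_curvature_end, fun h' => absurd h h'⟩,
      ⟨fun _ => H.add_nonneg_angle, fun h' => absurd h h'⟩⟩
    · rintro _ ⟨s, hs, rfl⟩; exact H.abs_x_le hs
    · rintro _ ⟨s, hs, rfl⟩; exact ⟨fun _ => H.arcA_le_y hs, fun h' => absurd h h'⟩
    · rintro _ ⟨s, hs, rfl⟩; exact ⟨fun _ => H.y_le_arcA hs, fun h' => absurd h h'⟩
  · have H := isSpiralOver_of_isCurveOn hcurve hsub hab ha hb hne hproj (Or.inr rfl)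
      (by simpa using (hdown h).neg)
    simp only [neg_one_mul] at H
    have h1 := H.curvature_start_le
    have h2 := H.le_curvature_end
    have h3 := H.add_nonneg_angle
    simp only [Real.sin_neg] at h1 h2
    refine ⟨H.pos, ?_, ?_, ?_, ?_, ?_, ⟨fun h' => absurd h' h, fun _ => by linarith⟩,
      ⟨fun h' => absurd h' h, fun _ => by linarith⟩, ⟨fun h' => absurd h' h, fun _ => by linarith⟩⟩
    · rw [← abs_neg]; exact abs_le.2 (H.range a haI)
    · rw [← abs_neg]; exact abs_le.2 (H.range b hbI)
    · rintro _ ⟨s, hs, rfl⟩; exact H.abs_x_le hs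
    · rintro _ ⟨s, hs, rfl⟩
      have h4 := H.arcA_le_y hs
      rw [arcA_neg, arcA_neg] at h4
      refine ⟨fun h' => absurd h' h, fun _ => ?_⟩
      rw [arcA_neg]
      simp only at h4 ⊢
      linarith
    · rintro _ ⟨s, hs, rfl⟩
      have h4 := H.y_le_arcA hs
      rw [arcA_neg] at h4
      refine ⟨fun h' => absurd h' h, fun _ => ?_⟩
      simp only at h4 ⊢
      linarith

/-- Moving the angle in the weakening direction is legitimate within (-π, π) only: hence the proviso
on the corrected arcs. -/
theorem FirstBound.mono {up : Prop} {c φ ψ : ℝ} {z : ℂ} (h : FirstBound up c φ z) (hc : 0 < c)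
    (hz : |z.re| ≤ c) (hφ : |φ| < Real.pi) (hψ : |ψ| < Real.pi) (hup : up → ψ ≤ φ)
    (hdown : ¬ up → φ ≤ ψ) : FirstBound up c ψ z := by
  rw [abs_lt] at hφ hψ
  exact ⟨fun hu => (arcA_mono hc hz hψ.1 (hup hu) hφ.2).trans (h.1 hu),
    fun hu => (h.2 hu).trans (arcA_mono hc hz hφ.1 (hdown hu) hψ.2)⟩

theorem SecondBound.mono {up : Prop} {c φ ψ : ℝ} {z : ℂ} (h : SecondBound up c φ z) (hc : 0 < c)
    (hz : |z.re| ≤ c) (hφ : |φ| < Real.pi) (hψ : |ψ| < Real.pi) (hup : up → φ ≤ ψ)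
    (hdown : ¬ up → ψ ≤ φ) : SecondBound up c ψ z := by
  rw [abs_lt] at hφ hψ
  exact ⟨fun hu => (h.1 hu).trans (arcA_mono hc hz hφ.1 (hup hu) hψ.2),
    fun hu => (arcA_mono hc hz hψ.1 (hdown hu) hφ.2).trans (h.2 hu)⟩

/-! ### Tangents and three-point circles at a node -/

/-- One bound has to be strict, since π and -π are congruent. -/
theorem eq_of_coe_eq {a b : ℝ} (h : (a : Real.Angle) = b) (ha : |a| ≤ Real.pi)
    (hb : |b| < Real.pi) : a = b := by
  rw [abs_le] at ha
  rw [abs_lt] at hb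
  have h1 : (b : Real.Angle).toReal = b := Real.Angle.toReal_coe_eq_self_iff.2 ⟨hb.1, hb.2.le⟩
  rcases ha.1.eq_or_lt with h2 | h2
  · rw [← h, ← h2, Real.Angle.coe_neg, Real.Angle.neg_coe_pi, Real.Angle.toReal_pi] at h1
    linarith
  · rw [← h, Real.Angle.toReal_coe_eq_self_iff.2 ⟨h2, ha.2⟩] at h1
    exact h1

/-- `h` says sin(α - arg z) ≤ 0. As |α - arg z| ≤ π, this yields the claim unless α = π/2 and arg z
= -π/2, which `hvert` excludes. -/
theorem le_arg_of_sin_mul_le {z : ℂ} {α : ℝ} (hz : z ≠ 0) (hre : 0 ≤ z.re)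
    (hα : |α| ≤ Real.pi / 2) (h : Real.sin α * z.re ≤ Real.cos α * z.im)
    (hvert : α = Real.pi / 2 → z.re = 0 → 0 ≤ z.im) : α ≤ z.arg := by
  by_contra! hlt
  have hz' := norm_pos_iff.2 hz
  have hψ := abs_le.1 (Complex.abs_arg_le_pi_div_two_iff.2 hre)
  rw [abs_le] at hα
  have e1 : z.re = ‖z‖ * Real.cos z.arg := (Complex.norm_mul_cos_arg z).symm
  have e2 : z.im = ‖z‖ * Real.sin z.arg := (Complex.norm_mul_sin_arg z).symm
  rcases (show α - z.arg ≤ Real.pi by linarith).eq_or_lt with h1 | h1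
  · have h2 : z.arg = -(Real.pi / 2) := by linarith
    have h3 := hvert (by linarith) (by rw [e1, h2]; simp)
    rw [e2, h2, Real.sin_neg, Real.sin_pi_div_two] at h3
    linarith
  · have h2 := mul_pos hz' (Real.sin_pos_of_pos_of_lt_pi (sub_pos.2 hlt) h1)
    rw [Real.sin_sub] at h2
    rw [e1, e2] at h
    linarith

/-- The tangent at the node `P_j` of a curve of nondecreasing curvature through `P_{j-1}`, `P_j`,
`P_{j+1}` against the circle through these points; `c₁`, `c₂` are the half-chords, `ρ` is the
turning angle, `α + ρ` and `α` are the directions of the tangent with respect to the chords. -/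
theorem le_arg_circle {c₁ c₂ α ρ : ℝ} (h₁ : 0 < c₁) (h₂ : 0 < c₂)
    (hρ : |ρ| < Real.pi) (hα : |α| ≤ Real.pi / 2) (hβ : |α + ρ| ≤ Real.pi / 2)
    (hre : 0 ≤ c₁ + c₂ * Real.cos ρ)
    (h : c₂ * Real.sin (α + ρ) + c₁ * Real.sin α ≤ 0) :
    α ≤ Complex.arg ⟨c₁ + c₂ * Real.cos ρ, -(c₂ * Real.sin ρ)⟩ := by
  rw [abs_lt] at hρ
  refine le_arg_of_sin_mul_le ?_ hre hα ?_ ?_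
  · intro h0
    have h1 : c₁ + c₂ * Real.cos ρ = 0 := congrArg Complex.re h0
    have h2 : -(c₂ * Real.sin ρ) = 0 := congrArg Complex.im h0
    have h3 : Real.sin ρ = 0 := by simpa [h₂.ne'] using h2
    rw [(Real.sin_eq_zero_iff_of_lt_of_lt hρ.1 hρ.2).1 h3, Real.cos_zero] at h1
    linarith
  · rw [Real.sin_add] at h
    linarith
  -- α = π/2 and |α + ρ| ≤ π/2 give ρ ≤ 0.
  · rintro rfl -
    have := Real.sin_nonpos_of_nonpos_of_neg_pi_le (x := ρ) (by linarith [(abs_le.1 hβ).2]) hρ.1.le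
    simp only [Left.nonneg_neg_iff]
    exact mul_nonpos_of_nonneg_of_nonpos h₂.le this

/-- The mirror image: negating α and ρ conjugates the complex number. -/
theorem arg_circle_le {c₁ c₂ α ρ : ℝ} (h₁ : 0 < c₁) (h₂ : 0 < c₂)
    (hρ : |ρ| < Real.pi) (hα : |α| ≤ Real.pi / 2) (hβ : |α + ρ| ≤ Real.pi / 2)
    (hre : 0 ≤ c₁ + c₂ * Real.cos ρ)
    (h : 0 ≤ c₂ * Real.sin (α + ρ) + c₁ * Real.sin α) :
    Complex.arg ⟨c₁ + c₂ * Real.cos ρ, -(c₂ * Real.sin ρ)⟩ ≤ α := by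
  have h1 := le_arg_circle (α := -α) (ρ := -ρ) h₁ h₂ (by rwa [abs_neg]) (by rwa [abs_neg])
    (by rwa [← neg_add, abs_neg]) (by rwa [Real.cos_neg])
    (by rw [← neg_add, Real.sin_neg, Real.sin_neg]; linarith)
  have h2 := Complex.abs_arg_le_pi_div_two_iff (z := ⟨c₁ + c₂ * Real.cos ρ, -(c₂ * Real.sin ρ)⟩)
    |>.2 hre
  have h3 : (⟨c₁ + c₂ * Real.cos (-ρ), -(c₂ * Real.sin (-ρ))⟩ : ℂ) =
      (starRingEnd ℂ) ⟨c₁ + c₂ * Real.cos ρ, -(c₂ * Real.sin ρ)⟩ := by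
    apply Complex.ext <;> simp
  rw [h3, Complex.arg_conj, if_neg (fun h4 => by
    rw [h4, abs_of_pos Real.pi_pos] at h2; linarith [Real.pi_pos])] at h1
  linarith

/-- For cos ρ = -1 the two half-turn inequalities force equal half-chords. -/
theorem abs_turn_lt_pi {c μ : ℤ → ℝ} {j : ℤ} (h : AtMostHalfTurn c μ j)
    (hne : turn μ j = Real.pi → c (j - 1) ≠ c j) : |turn μ j| < Real.pi := by
  rw [abs_lt]
  refine ⟨Real.Angle.neg_pi_lt_toReal _, lt_of_le_of_ne (Real.Angle.toReal_le_pi _) fun hp => ?_⟩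
  obtain ⟨h1, h2⟩ := h
  rw [turn] at hp
  rw [turn, hp, Real.cos_pi] at h1 h2
  exact hne (by rw [turn, hp]) (by linarith)

/-- At a node between two chords a half-turn is only possible for chords of different lengths. -/
theorem chordHalf_ne_of_turn_eq_pi {P : ℤ → ℂ} {j : ℤ} (h3 : P (j - 1) ≠ P (j + 1))
    (h : ((chordDir P j - chordDir P (j - 1) : ℝ) : Real.Angle).toReal = Real.pi) :
    chordHalf P (j - 1) ≠ chordHalf P j := by
  intro he
  apply h3
  rw [Real.Angle.toReal_eq_pi_iff, Real.Angle.coe_sub, sub_eq_iff_eq_add,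
    ← Real.Angle.coe_add] at h
  have e1 := norm_mul_nvec_arg (P (j + 1) - P j)
  have e2 := norm_mul_nvec_arg (P (j - 1 + 1) - P (j - 1))
  have e3 : nvec (Complex.arg (P (j + 1) - P j)) =
      -nvec (Complex.arg (P (j - 1 + 1) - P (j - 1))) := by
    have hc := congrArg Real.Angle.cos h
    have hs := congrArg Real.Angle.sin h
    rw [Real.Angle.cos_coe, Real.Angle.cos_coe, add_comm, Real.cos_add_pi] at hc
    rw [Real.Angle.sin_coe, Real.Angle.sin_coe, add_comm, Real.sin_add_pi] at hs
    apply Complex.ext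
    · rw [Complex.neg_re, nvec_re, nvec_re]; exact hc
    · rw [Complex.neg_im, nvec_im, nvec_im]; exact hs
  have e4 : ‖P (j - 1 + 1) - P (j - 1)‖ = ‖P (j + 1) - P j‖ := by
    rw [chordHalf, chordHalf] at he; linarith
  rw [e3, ← e4, mul_neg, e2, sub_add_cancel] at e1
  linear_combination e1

/-! ### The table of boundary arcs -/

theorem abs_xi_le {c μ : ℤ → ℝ} {j : ℤ} (h : AtMostHalfTurn c μ j) :
    |xi c μ j| ≤ Real.pi / 2 :=
  Complex.abs_arg_le_pi_div_two_iff.2 h.1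

theorem abs_eta_le {c μ : ℤ → ℝ} {j : ℤ} (h : AtMostHalfTurn c μ (j + 1)) :
    |eta c μ j| ≤ Real.pi / 2 := by
  have := h.2
  rw [add_sub_cancel_right] at this
  exact Complex.abs_arg_le_pi_div_two_iff.2 this

/-- At an inner node that is not a vertex the tangent is bounded by the three-point circle. -/
theorem tangent_bounds_of_not_mem {c μ α β κ : ℤ → ℝ} {up : ℤ → Prop} {Z : ℤ → Set ℂ} {j : ℤ}
    (hl : SpiralChord (up (j - 1)) (c (j - 1)) (α (j - 1)) (β (j - 1)) (κ (j - 1)) (κ j)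
      (Z (j - 1)))
    (hr : SpiralChord (up j) (c j) (α j) (β j) (κ j) (κ (j + 1)) (Z j))
    (hup : up (j - 1) ↔ up j) (hρ : |turn μ j| < Real.pi) (hβ : β (j - 1) = α j + turn μ j)
    (hh : AtMostHalfTurn c μ j) :
    ((up j → α j ≤ xi c μ j) ∧ (¬ up j → xi c μ j ≤ α j)) ∧
    ((up j → β (j - 1) ≤ eta c μ (j - 1)) ∧ (¬ up j → eta c μ (j - 1) ≤ β (j - 1))) := by
  have hp1 := hl.pos
  have hp2 := hr.pos
  have ha := hr.abs_start
  have hb := hl.abs_end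
  have hα : α j = β (j - 1) + -turn μ j := by linarith
  -- η is ξ for the node traversed backwards: the chords swap and ρ changes sign.
  have e : eta c μ (j - 1) = Complex.arg ⟨c j + c (j - 1) * Real.cos (-turn μ j),
      -(c (j - 1) * Real.sin (-turn μ j))⟩ := by
    simp [eta]
  rw [e, xi]
  have hb' : |α j + turn μ j| ≤ Real.pi / 2 := by rwa [← hβ]
  have ha' : |β (j - 1) + -turn μ j| ≤ Real.pi / 2 := by rwa [← hα]
  have hρ' : |-turn μ j| < Real.pi := by rwa [abs_neg]
  have hre : 0 ≤ c j + c (j - 1) * Real.cos (-turn μ j) := by rw [Real.cos_neg]; exact hh.2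
  -- sin β_{j-1} / c_{j-1} ≤ κ_j ≤ -sin α_j / c_j, with the common node curvature κ_j eliminated.
  have hu : up j → c j * Real.sin (β (j - 1)) + c (j - 1) * Real.sin (α j) ≤ 0 := fun hu => by
    have h1 := mul_le_mul_of_nonneg_left (hl.curv_end.1 (hup.2 hu)) hp2.le
    have h2 := mul_le_mul_of_nonneg_left (hr.curv_start.1 hu) hp1.le
    linarith
  have hd : ¬ up j → 0 ≤ c j * Real.sin (β (j - 1)) + c (j - 1) * Real.sin (α j) := fun hu => by
    have h1 := mul_le_mul_of_nonneg_left (hl.curv_end.2 (fun h => hu (hup.1 h))) hp2.le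
    have h2 := mul_le_mul_of_nonneg_left (hr.curv_start.2 hu) hp1.le
    linarith
  refine ⟨⟨fun h => ?_, fun h => ?_⟩, ⟨fun h => ?_, fun h => ?_⟩⟩
  · exact le_arg_circle hp1 hp2 hρ ha hb' hh.1 (by rw [← hβ]; exact hu h)
  · exact arg_circle_le hp1 hp2 hρ ha hb' hh.1 (by rw [← hβ]; exact hd h)
  · exact le_arg_circle hp2 hp1 hρ' hb ha' hre (by rw [← hα]; linarith [hu h])
  · exact arg_circle_le hp2 hp1 hρ' hb ha' hre (by rw [← hα]; linarith [hd h])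

/-- The arcs with the true end tangents already bound the segment, so what remains is to compare the
angles α, β with those of the table. -/
theorem boundedByTable_of_spiralChord {P : ℤ → ℂ} {c μ α β κ t : ℤ → ℝ} {γ : ℝ → ℂ}
    {up : ℤ → Prop} {chords inner V : Set ℤ}
    (hchord : ∀ j ∈ chords, SpiralChord (up j) (c j) (α j) (β j) (κ j) (κ (j + 1))
      ((fun s => localCoord P j (γ s)) '' Set.Icc (t j) (t (j + 1))))
    (hinner : ∀ j ∈ inner, j - 1 ∈ chords ∧ j ∈ chords)
    (hturn : ∀ j ∈ inner, |turn μ j| < Real.pi ∧ β (j - 1) = α j + turn μ j)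
    (hstart : ∀ j ∈ chords, j ∉ inner → α j = xi c μ j)
    (hend : ∀ j ∈ chords, j + 1 ∉ inner → β j = eta c μ j)
    (hhalf : ∀ j ∈ chords, AtMostHalfTurn c μ j ∧ AtMostHalfTurn c μ (j + 1))
    (hV : V ⊆ inner) (hvert : TurnsExactlyAt up inner V) (hsep : ∀ j ∈ V, j + 1 ∉ V)
    {j : ℤ} (hj : j ∈ chords) : BoundedByTable P c μ γ t up V j := by
  have hnode : ∀ j ∈ inner, j ∉ V →
      ((up j → α j ≤ xi c μ j) ∧ (¬ up j → xi c μ j ≤ α j)) ∧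
      ((up j → β (j - 1) ≤ eta c μ (j - 1)) ∧ (¬ up j → eta c μ (j - 1) ≤ β (j - 1))) := by
    intro j hj hjV
    have hl := hchord _ (hinner j hj).1
    rw [show j - 1 + 1 = j by ring] at hl
    exact tangent_bounds_of_not_mem (Z := fun i => (fun s => localCoord P i (γ s)) ''
      Set.Icc (t i) (t (i + 1))) (by simpa using hl) (hchord j (hinner j hj).2)
      (not_not.1 fun h => hjV ((hvert j hj).2 h)) (hturn j hj).1 (hturn j hj).2
      (hhalf j (hinner j hj).2).1
  have hα : ∀ j ∈ chords, j ∉ V → (up j → α j ≤ xi c μ j) ∧ (¬ up j → xi c μ j ≤ α j) := by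
    intro j hj hjV
    by_cases hji : j ∈ inner
    · exact (hnode j hji hjV).1
    · rw [hstart j hj hji]; exact ⟨fun _ => le_rfl, fun _ => le_rfl⟩
  have hβ : ∀ j ∈ chords, j + 1 ∉ V →
      (up j → β j ≤ eta c μ j) ∧ (¬ up j → eta c μ j ≤ β j) := by
    intro j hj hjV
    by_cases hji : j + 1 ∈ inner
    · have h1 := (hnode _ hji hjV).2
      have h2 : up (j + 1 - 1) ↔ up (j + 1) := not_not.1 fun h => hjV ((hvert _ hji).2 h)
      rw [add_sub_cancel_right] at h1 h2
      rwa [h2]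
    · rw [hend j hj hji]; exact ⟨fun _ => le_rfl, fun _ => le_rfl⟩
  have hpi := Real.pi_pos
  have H := hchord j hj
  have hhj := hhalf j hj
  intro s hs
  have hz : localCoord P j (γ s) ∈
      (fun s => localCoord P j (γ s)) '' Set.Icc (t j) (t (j + 1)) := ⟨s, hs, rfl⟩
  have hfirst : ∀ ψ, |ψ| < Real.pi → (up j → ψ ≤ -β j) → (¬ up j → -β j ≤ ψ) →
      FirstBound (up j) (c j) ψ (localCoord P j (γ s)) := fun ψ hψ =>
    (H.first _ hz).mono H.pos (H.abs_re _ hz) (by rw [abs_neg]; linarith [H.abs_end]) hψ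
  have hsecond : ∀ ψ, |ψ| < Real.pi → (up j → α j ≤ ψ) → (¬ up j → ψ ≤ α j) →
      SecondBound (up j) (c j) ψ (localCoord P j (γ s)) := fun ψ hψ =>
    (H.second _ hz).mono H.pos (H.abs_re _ hz) (by linarith [H.abs_start]) hψ
  have hfirst' : j + 1 ∉ V → FirstBound (up j) (c j) (-eta c μ j) (localCoord P j (γ s)) :=
    fun hV' => hfirst _ (by rw [abs_neg]; linarith [abs_eta_le hhj.2])
      (fun hu => neg_le_neg ((hβ j hj hV').1 hu)) (fun hu => neg_le_neg ((hβ j hj hV').2 hu))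
  have hsecond' : j ∉ V → SecondBound (up j) (c j) (xi c μ j) (localCoord P j (γ s)) :=
    fun hV' => hsecond _ (by linarith [abs_xi_le hhj.1]) (hα j hj hV').1 (hα j hj hV').2
  refine ⟨fun hjV hjV' => ⟨hfirst' hjV', fun hψ => ?_⟩, fun hjV hjV' => ⟨fun hψ => ?_, hsecond' hjV⟩,
    fun hjV hjV' => ⟨hfirst' hjV', hsecond' hjV⟩⟩
  -- Across the vertex the sense changes, and P_{j-1} is not a vertex: its bound by ξ_{j-1} passes
  -- through Vogt's inequality on the preceding chord and β_{j-1} = α_j + ρ_j to α_j.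
  · have hi := hV hjV
    have hchg := (hvert j hi).1 hjV
    have hl := (hinner j hi).1
    have hlV : j - 1 ∉ V := fun h => hsep _ h (by rwa [sub_add_cancel])
    have h1 := hα _ hl hlV
    have h2 := (hchord _ hl).vogt
    have h3 := (hturn j hi).2
    refine hsecond _ hψ (fun hu => ?_) (fun hu => ?_)
    · have hd : ¬ up (j - 1) := fun h => hchg ⟨fun _ => hu, fun _ => h⟩
      linarith [h1.2 hd, h2.2 hd]
    · have hd : up (j - 1) := by
        by_contra h; exact hchg ⟨fun h' => absurd h' h, fun h' => absurd h' hu⟩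
      linarith [h1.1 hd, h2.1 hd]
  · have hi := hV hjV'
    have hchg := (hvert _ hi).1 hjV'
    have hr := (hinner _ hi).2
    have h1 := hβ _ hr (hsep _ hjV')
    have h2 := (hchord _ hr).vogt
    have h3 := (hturn _ hi).2
    rw [add_sub_cancel_right] at h3 hchg
    refine hfirst _ hψ (fun hu => ?_) (fun hu => ?_)
    · have hd : ¬ up (j + 1) := fun h => hchg ⟨fun _ => h, fun _ => hu⟩
      linarith [h1.2 hd, h2.2 hd]
    · have hd : up (j + 1) := by
        by_contra h; exact hchg ⟨fun h' => absurd h' hu, fun h' => absurd h' h⟩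
      linarith [h1.1 hd, h2.1 hd]

/-- A piecewise spiral interpolant is bounded by the table if `c`, `μ` are the data of the chords
and at the ends, if any, the directions `μ` are those of the tangents. -/
theorem IsPiecewiseSpiral.boundedByTable {P : ℤ → ℂ} {c μ : ℤ → ℝ} {γ : ℝ → ℂ} {θ k : ℝ → ℝ}
    {t : ℤ → ℝ} {up : ℤ → Prop} {chords nodes inner V : Set ℤ} {S : Set ℝ}
    (h : IsPiecewiseSpiral P c μ γ θ k t up chords nodes inner V S)
    (hc : ∀ j ∈ chords, c j = chordHalf P j) (hμ : ∀ j ∈ chords, μ j = chordDir P j)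
    (hnodes : ∀ j ∈ chords, j ∈ nodes ∧ j + 1 ∈ nodes)
    (hS : ∀ j ∈ chords, Set.Icc (t j) (t (j + 1)) ⊆ S)
    (hinner : ∀ j ∈ inner, j - 1 ∈ chords ∧ j ∈ chords)
    (hstart : ∀ j ∈ chords, j ∉ inner →
      c (j - 1) = 0 ∧ (μ (j - 1) : Real.Angle) = (θ (t j) : Real.Angle))
    (hend : ∀ j ∈ chords, j + 1 ∉ inner →
      c (j + 1) = 0 ∧ (μ (j + 1) : Real.Angle) = (θ (t (j + 1)) : Real.Angle))
    {j : ℤ} (hj : j ∈ chords) : BoundedByTable P c μ γ t up V j := by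
  have hpi := Real.pi_pos
  have hchord : ∀ j ∈ chords, SpiralChord (up j) (c j) (relAngle P θ j (t j))
      (relAngle P θ j (t (j + 1))) (k (t j)) (k (t (j + 1)))
      ((fun s => localCoord P j (γ s)) '' Set.Icc (t j) (t (j + 1))) := fun j hj => by
    rw [hc j hj]
    exact spiralChord_of_isCurveOn h.curve (hS j hj)
      (h.param (hnodes j hj).1 (hnodes j hj).2 (by linarith))
      (h.interp j (hnodes j hj).1) (h.interp _ (hnodes j hj).2) (h.distinct j hj)
      (h.projectable j hj) (h.vertices_curve.1 j hj).1 (h.vertices_curve.1 j hj).2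
  refine boundedByTable_of_spiralChord (inner := inner) (α := fun j => relAngle P θ j (t j))
    (β := fun j => relAngle P θ j (t (j + 1))) (κ := fun j => k (t j)) hchord hinner
    (fun j hj => ?_) (fun j hj hji => ?_) (fun j hj hji => ?_)
    (fun j hj => ⟨h.halfTurn _ (hnodes j hj).1, h.halfTurn _ (hnodes j hj).2⟩) h.vertices_inner
    h.vertices_curve.2 h.separated hj
  · obtain ⟨hl, hr⟩ := hinner j hj
    have hρ : |turn μ j| < Real.pi := by
      refine abs_turn_lt_pi (h.halfTurn _ (hnodes j hr).1) fun hp => ?_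
      rw [turn, hμ j hr, hμ _ hl] at hp
      rw [hc _ hl, hc _ hr]
      exact chordHalf_ne_of_turn_eq_pi (h.distinct3 j hj) hp
    refine ⟨hρ, ?_⟩
    have hb := abs_le.1 (hchord _ hl).abs_end
    have ha := abs_le.1 (hchord _ hr).abs_start
    simp only [sub_add_cancel] at hb ⊢
    rw [← sub_eq_iff_eq_add']
    -- The relation is clear modulo 2π; it holds for real numbers because |β_{j-1} - α_j| ≤ π and
    -- |ρ_j| < π.
    refine eq_of_coe_eq ?_ (abs_le.2 ⟨by linarith, by linarith⟩) hρ
    rw [turn, Real.Angle.coe_toReal, Real.Angle.coe_sub, relAngle, relAngle, Real.Angle.coe_toReal,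
      Real.Angle.coe_toReal, ← Real.Angle.coe_sub, hμ _ hl, hμ _ hr]
    congr 1; ring
  · obtain ⟨h0, hθ⟩ := hstart j hj hji
    have ha := (hchord j hj).abs_start
    have hp := (hchord j hj).pos
    refine eq_of_coe_eq ?_ (by linarith) (by linarith [abs_xi_le (h.halfTurn _ (hnodes j hj).1)])
    -- With c_{j-1} = 0 the vector is c_j n(-ρ_j), so ξ_j is the direction of the prescribed
    -- tangent.
    have e : (⟨c (j - 1) + c j * Real.cos (turn μ j), -(c j * Real.sin (turn μ j))⟩ : ℂ) =
        c j * (Real.Angle.cos (-(turn μ j : Real.Angle)) +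
          Real.Angle.sin (-(turn μ j : Real.Angle)) * Complex.I) := by
      rw [Real.Angle.cos_neg, Real.Angle.sin_neg, Real.Angle.cos_coe, Real.Angle.sin_coe]
      apply Complex.ext <;> simp [h0, -Complex.ofReal_cos, -Complex.ofReal_sin]
    rw [xi, e, Complex.arg_mul_cos_add_sin_mul_I_coe_angle hp, turn, Real.Angle.coe_toReal, relAngle,
      Real.Angle.coe_toReal, Real.Angle.coe_sub, Real.Angle.coe_sub, hθ, hμ j hj, neg_sub]
  · obtain ⟨h0, hθ⟩ := hend j hj hji
    have ha := (hchord j hj).abs_end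
    have hp := (hchord j hj).pos
    refine eq_of_coe_eq ?_ (by linarith) (by linarith [abs_eta_le (h.halfTurn _ (hnodes j hj).2)])
    have e : (⟨c (j + 1) + c j * Real.cos (turn μ (j + 1)), c j * Real.sin (turn μ (j + 1))⟩ : ℂ) =
        c j * (Real.Angle.cos (turn μ (j + 1) : Real.Angle) +
          Real.Angle.sin (turn μ (j + 1) : Real.Angle) * Complex.I) := by
      rw [Real.Angle.cos_coe, Real.Angle.sin_coe]
      apply Complex.ext <;> simp [h0, -Complex.ofReal_cos, -Complex.ofReal_sin]
    rw [eta, e, Complex.arg_mul_cos_add_sin_mul_I_coe_angle hp, turn, Real.Angle.coe_toReal,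
      relAngle, Real.Angle.coe_toReal, Real.Angle.coe_sub, Real.Angle.coe_sub, hθ,
      add_sub_cancel_right, hμ j hj]

end

/-! ### Open and closed data -/

theorem proposition3 (P : ℤ → ℂ) (γ : ℝ → ℂ) (θ k : ℝ → ℝ) (t : ℤ → ℝ) (up : ℤ → Prop)
    (V : Set ℤ) :
    -- nodes `P_1, …, P_N` with prescribed tangents `n(τ₁)`, `n(τ₂)` at the two ends
    (∀ (N : ℕ) (τ₁ τ₂ : ℝ), 2 ≤ N →
      nvec (θ (t 1)) = nvec τ₁ → nvec (θ (t N)) = nvec τ₂ →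
      IsPiecewiseSpiral P (openHalf P N) (openDir P N τ₁ τ₂) γ θ k t up
        (Set.Ico 1 (N : ℤ)) (Set.Icc 1 (N : ℤ)) (Set.Ioo 1 (N : ℤ)) V
        (Set.Icc (t 1) (t N)) →
      ∀ j ∈ Set.Ico 1 (N : ℤ),
        BoundedByTable P (openHalf P N) (openDir P N τ₁ τ₂) γ t up V j) ∧
    -- closed curve of length `L` with nodes `P_1, …, P_N`, indices being taken modulo `N`
    (∀ (N : ℕ) (L : ℝ), 3 ≤ N →
      (∀ j, P (j + N) = P j) → (∀ j, t (j + N) = t j + L) → (∀ j, j + (N : ℤ) ∈ V ↔ j ∈ V) →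
      (∀ s, γ (s + L) = γ s) → (∀ s, k (s + L) = k s) →
      IsPiecewiseSpiral P (chordHalf P) (chordDir P) γ θ k t up
        Set.univ Set.univ Set.univ V Set.univ →
      ∀ j, BoundedByTable P (chordHalf P) (chordDir P) γ t up V j) := by
  refine ⟨fun N τ₁ τ₂ hN h₁ h₂ h j hj => ?_, fun N L hN hP ht hV hγ hk h j => ?_⟩
  · have hchord : ∀ j ∈ Set.Ico 1 (N : ℤ), 1 ≤ j ∧ j < N := fun j hj => hj
    have htmono : ∀ i ∈ Set.Icc 1 (N : ℤ), ∀ j ∈ Set.Icc 1 (N : ℤ), i ≤ j → t i ≤ t j :=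
      fun i hi j hj hij => h.param.monotoneOn hi hj hij
    refine h.boundedByTable (fun j hj => if_pos (hchord j hj)) (fun j hj => ?_) (fun j hj => ?_)
      (fun j hj => ?_) (fun j hj => ?_) (fun j hj hji => ?_) (fun j hj hji => ?_) hj
    · rw [openDir, if_neg (not_lt.2 hj.1), if_pos hj.2]
    · have := hj.1; have := hj.2
      simp only [Set.mem_Icc]; omega
    · have := hj.1; have := hj.2
      exact Set.Icc_subset_Icc
        (htmono _ (by simp only [Set.mem_Icc]; omega) _ (by simp only [Set.mem_Icc]; omega) hj.1)
        (htmono _ (by simp only [Set.mem_Icc]; omega) _ (by simp only [Set.mem_Icc]; omega) hj.2)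
    · have := hj.1; have := hj.2
      simp only [Set.mem_Ico]; omega
    · obtain rfl : j = 1 := by
        have := hj.1; have := hj.2
        simp only [Set.mem_Ioo] at hji; omega
      exact ⟨by simp [openHalf], by simpa [openDir] using (coe_eq_coe_of_nvec_eq h₁).symm⟩
    · obtain rfl : j = N - 1 := by
        have := hj.1; have := hj.2
        simp only [Set.mem_Ioo] at hji; omega
      rw [sub_add_cancel]
      refine ⟨by simp [openHalf], ?_⟩
      rw [openDir, if_neg (by omega), if_neg (by omega)]
      exact (coe_eq_coe_of_nvec_eq h₂).symm
  -- The closed curve is unrolled over ℤ: every node is inner, and the end conditions are vacuous.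
  · exact h.boundedByTable (fun _ _ => rfl) (fun _ _ => rfl) (fun _ _ => ⟨trivial, trivial⟩)
      (fun _ _ => Set.subset_univ _) (fun _ _ => ⟨trivial, trivial⟩)
      (fun _ _ hji => absurd trivial hji) (fun _ _ hji => absurd trivial hji) (Set.mem_univ j)
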